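/- Let $\xi_1,\xi_2,\ldots$ be independent identically distributed random variables with values in $\{0,1,2,\ldots\}$ and $\mathbf P(\xi_1=i)=p_i>0$ for all $i\ge 0$, $\sum_{i\ge 0}p_i=1$. For $n\ge 0$ put $R(n)=-\ln\bigl(\sum_{i\ge n}p_i\bigr)$, for $n\ge 1$ put $r(n)=R(n)-R(n-1)$, $a_n=\max\{k\ge 0:\ \sum_{i\ge k}p_i\ge 1/n\}$ and $\bar\xi_n=\max_{1\le i\le n}\xi_i$. Suppose that $r(n)$, $n\ge 1$, is monotone and that $r(n)\to\infty$ as $n\to\infty$. Let $m\ge 1$ be an integer such that the series $\sum_{k\ge 1}\exp(-j\,r(k))$ converges for $j=m$ and diverges for $j=m-1$. Then (i) almost surely $\limsup_{n\to\infty}(\bar\xi_n-a_n)=m$, and almost surely $\liminf_{n\to\infty}(\bar\xi_n-a_n)=-1$; (ii) for every integer $l\in\{-1,0,1,\ldots,m\}$, almost surely $\bar\xi_n=a_n+l$ for infinitely many $n$. -/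

import Mathlib

namespace DiscreteExtremes

open Filter Topology MeasureTheory

/-- The tail `P(ξ ≥ n) = ∑_{i ≥ n} p i` of the distribution `p` on `{0, 1, 2, …}`. -/
noncomputable def tail (p : ℕ → ℝ) (n : ℕ) : ℝ := ∑' i : ℕ, p (n + i)

/-- `R(n) = -ln P(ξ ≥ n)`. -/
noncomputable def R (p : ℕ → ℝ) (n : ℕ) : ℝ := -Real.log (tail p n)

/-- `r(n) = R(n) - R(n - 1)`; only the values at `n ≥ 1` are meaningful. -/
noncomputable def r (p : ℕ → ℝ) (n : ℕ) : ℝ := R p n - R p (n - 1)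

/-- `a_n = max {k ≥ 0 : ∑_{i ≥ k} p i ≥ 1 / n}` for `n ≥ 1`. -/
noncomputable def a (p : ℕ → ℝ) (n : ℕ) : ℕ := sSup {k : ℕ | 1 / (n : ℝ) ≤ tail p k}

/-- The maximum of the first `n` variables of the sequence `ξ 0, ξ 1, ξ 2, …`, for `n ≥ 1`. -/
def runMax {Ω : Type*} (ξ : ℕ → Ω → ℕ) (n : ℕ) (ω : Ω) : ℕ :=
  (Finset.range n).sup fun i => ξ i ω

/-- For a probability distribution the maximum that defines `a_n` is attained. -/
theorem isGreatest_a {p : ℕ → ℝ} (hp : HasSum p 1) {n : ℕ} (hn : 1 ≤ n) :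
    IsGreatest {k : ℕ | 1 / (n : ℝ) ≤ tail p k} (a p n) := by
  have hn' : (1 : ℝ) ≤ n := by exact_mod_cast hn
  have h0 : 0 ∈ {k : ℕ | 1 / (n : ℝ) ≤ tail p k} := by
    have ht : tail p 0 = 1 := by simp [tail, hp.tsum_eq]
    change 1 / (n : ℝ) ≤ tail p 0
    rw [ht, div_le_one (by linarith)]
    exact hn'
  have hlim : Tendsto (tail p) atTop (𝓝 0) := by
    have h := tendsto_sum_nat_add p
    refine h.congr fun i => ?_
    simp [tail, add_comm]
  have hev : ∀ᶠ k in atTop, tail p k < 1 / (n : ℝ) :=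
    hlim.eventually_lt_const (by positivity)
  obtain ⟨N, hN⟩ := eventually_atTop.1 hev
  have hb : BddAbove {k : ℕ | 1 / (n : ℝ) ≤ tail p k} := by
    refine ⟨N, fun k hk => ?_⟩
    by_contra hlt
    exact absurd (hN k (by omega)) (not_lt.2 hk)
  exact ⟨Nat.sSup_mem ⟨0, h0⟩ hb, fun k hk => le_csSup hb hk⟩

end DiscreteExtremes

/-! Write `N k` for `levelTime p k`, so `a p n = k` exactly for `N k ≤ n < N (k + 1)`, and `N k *
tail p k` lies in `[1, 2]`. Four almost sure facts give everything. Upper bound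
(`ae_eventually_runMax_le`): some variable before `N (k + 1)` reaches `k + 1 + m` with probability
at most a constant times `exp (-m r(k + 2))`, a summable bound. Lower bound
(`ae_eventually_le_runMax`): all variables before `N (k + 1)` stay below `k` with probability at
most `exp (-exp (r(k + 1)))`, also summable. Level `m` is reached (`ae_frequently_le_runMax`): over
disjoint time blocks the exceedance events are independent, with probabilities dominating the
divergent series. Level `-1` is reached (`ae_frequently_runMax_lt`): at time `N (k + 1)` the maximum
is still at most `k` with probability bounded below; a sparse choice of `k` makes the past
negligible and leaves independent blocks. Intermediate levels follow since `runMax` never falls and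
`a` eventually rises by at most one per step. -/

namespace DiscreteExtremes

open Filter Topology MeasureTheory ProbabilityTheory

/-! ### Tails, increments of `R`, and the times at which `a` passes a level. -/

section Tail

variable {p : ℕ → ℝ}

theorem summable_shift (hp : HasSum p 1) (n : ℕ) : Summable fun i => p (n + i) := by
  simpa only [add_comm] using (summable_nat_add_iff n).2 hp.summable

theorem tail_zero (hp : HasSum p 1) : tail p 0 = 1 := by simp [tail, hp.tsum_eq]

theorem tail_eq_add (hp : HasSum p 1) (n : ℕ) : tail p n = p n + tail p (n + 1) := by
  rw [tail, (summable_shift hp n).tsum_eq_zero_add, tail]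
  simp only [add_zero]
  congr 2
  ext i
  congr 1
  omega

theorem tail_pos (h0 : ∀ i, 0 < p i) (hp : HasSum p 1) (n : ℕ) : 0 < tail p n :=
  (summable_shift hp n).tsum_pos (fun _ => (h0 _).le) 0 (h0 _)

theorem tail_antitone (h0 : ∀ i, 0 < p i) (hp : HasSum p 1) : Antitone (tail p) :=
  antitone_nat_of_succ_le fun n => by linarith [tail_eq_add hp n, h0 n]

theorem tail_le_one (h0 : ∀ i, 0 < p i) (hp : HasSum p 1) (n : ℕ) : tail p n ≤ 1 :=
  tail_zero hp ▸ tail_antitone h0 hp (Nat.zero_le n)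

theorem sum_range_eq_one_sub_tail (hp : HasSum p 1) (n : ℕ) :
    ∑ i ∈ Finset.range n, p i = 1 - tail p n := by
  induction n with
  | zero => simp [tail_zero hp]
  | succ n ih => rw [Finset.sum_range_succ, ih, tail_eq_add hp n]; ring

theorem tail_succ_eq_exp_mul (h0 : ∀ i, 0 < p i) (hp : HasSum p 1) (n : ℕ) :
    tail p (n + 1) = Real.exp (-r p (n + 1)) * tail p n := by
  have h1 := tail_pos h0 hp n
  have h2 := tail_pos h0 hp (n + 1)
  have : -r p (n + 1) = Real.log (tail p (n + 1)) - Real.log (tail p n) := by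
    simp only [r, R, Nat.add_sub_cancel]
    ring
  rw [this, Real.exp_sub, Real.exp_log h1, Real.exp_log h2]
  field_simp

theorem tail_add_le (h0 : ∀ i, 0 < p i) (hp : HasSum p 1)
    (hr : MonotoneOn (r p) (Set.Ici 1)) (k j : ℕ) :
    tail p (k + j) ≤ Real.exp (-(j * r p (k + 1))) * tail p k := by
  induction j with
  | zero => simp
  | succ j ih =>
    have hm : r p (k + 1) ≤ r p (k + j + 1) := hr (by simp) (by simp) (by omega)
    rw [← add_assoc, tail_succ_eq_exp_mul h0 hp]
    calc _ ≤ Real.exp (-r p (k + 1)) * (Real.exp (-(j * r p (k + 1))) * tail p k) := by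
          gcongr
          exact (tail_pos h0 hp _).le
      _ = _ := by
        rw [← mul_assoc, ← Real.exp_add]
        push_cast
        ring_nf

theorem le_tail_add (h0 : ∀ i, 0 < p i) (hp : HasSum p 1)
    (hr : MonotoneOn (r p) (Set.Ici 1)) {k j : ℕ} (hkj : 1 ≤ k + j) :
    Real.exp (-(j * r p (k + j))) * tail p k ≤ tail p (k + j) := by
  -- The rate `r p (k + j)` itself moves with `j`, so the induction runs with the top index `N`
  -- frozen.
  suffices ∀ N, 1 ≤ N → ∀ i, k + i ≤ N →
      Real.exp (-(i * r p N)) * tail p k ≤ tail p (k + i) from this _ hkj j le_rfl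
  intro N hN i
  induction i with
  | zero => simp
  | succ i ih =>
    intro hi
    have hm : r p (k + i + 1) ≤ r p N := hr (by simp) hN (by omega)
    rw [← add_assoc, tail_succ_eq_exp_mul h0 hp]
    calc _ = Real.exp (-r p N) * (Real.exp (-(i * r p N)) * tail p k) := by
          rw [← mul_assoc, ← Real.exp_add]
          push_cast
          ring_nf
      _ ≤ _ := by
          have h1 := ih (by omega)
          have h2 := tail_pos h0 hp k
          gcongr

theorem eventually_tail_succ_le (h0 : ∀ i, 0 < p i) (hp : HasSum p 1)
    (hr : Tendsto (r p) atTop atTop) {ε : ℝ} (hε : 0 < ε) :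
    ∀ᶠ k in atTop, tail p (k + 1) ≤ ε * tail p k := by
  have h : Tendsto (fun k => Real.exp (-r p (k + 1))) atTop (𝓝 0) :=
    Real.tendsto_exp_neg_atTop_nhds_zero.comp (hr.comp (tendsto_add_atTop_nat 1))
  filter_upwards [h.eventually_le_const hε] with k hk
  rw [tail_succ_eq_exp_mul h0 hp]
  exact mul_le_mul_of_nonneg_right hk (tail_pos h0 hp k).le

/-- The least `n` with `k ≤ a_n`. -/
noncomputable def levelTime (p : ℕ → ℝ) (k : ℕ) : ℕ := ⌈1 / tail p k⌉₊

theorem le_a_iff (h0 : ∀ i, 0 < p i) (hp : HasSum p 1) {n k : ℕ} (hn : 1 ≤ n) :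
    k ≤ a p n ↔ levelTime p k ≤ n := by
  have hn' : (0 : ℝ) < n := by exact_mod_cast hn
  have key : levelTime p k ≤ n ↔ 1 / (n : ℝ) ≤ tail p k := by
    rw [levelTime, Nat.ceil_le, one_div_le (tail_pos h0 hp k) hn']
  rw [key]
  have hg := isGreatest_a hp hn
  exact ⟨fun h => le_trans hg.1 (tail_antitone h0 hp h), fun h => hg.2 h⟩

theorem one_le_levelTime (h0 : ∀ i, 0 < p i) (hp : HasSum p 1) (k : ℕ) : 1 ≤ levelTime p k :=
  Nat.ceil_pos.2 (one_div_pos.2 (tail_pos h0 hp k))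

theorem levelTime_mono (h0 : ∀ i, 0 < p i) (hp : HasSum p 1) : Monotone (levelTime p) :=
  fun _ _ h => Nat.ceil_mono
    (one_div_le_one_div_of_le (tail_pos h0 hp _) (tail_antitone h0 hp h))

theorem one_div_le_levelTime (p : ℕ → ℝ) (k : ℕ) : 1 / tail p k ≤ levelTime p k := Nat.le_ceil _

theorem levelTime_lt (h0 : ∀ i, 0 < p i) (hp : HasSum p 1) (k : ℕ) :
    (levelTime p k : ℝ) < 1 / tail p k + 1 :=
  Nat.ceil_lt_add_one (one_div_pos.2 (tail_pos h0 hp k)).le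

theorem tendsto_a (h0 : ∀ i, 0 < p i) (hp : HasSum p 1) : Tendsto (a p) atTop atTop := by
  refine tendsto_atTop.2 fun k => ?_
  filter_upwards [eventually_ge_atTop (levelTime p k), eventually_ge_atTop 1] with n hn hn1
  exact (le_a_iff h0 hp hn1).2 hn

/-- A jump by two would force consecutive level times to coincide, but `1 / tail p` at least triples
from one level to the next, which beats the rounding error of the ceiling. -/
theorem eventually_a_succ_le (h0 : ∀ i, 0 < p i) (hp : HasSum p 1)
    (hr : Tendsto (r p) atTop atTop) : ∀ᶠ n in atTop, a p (n + 1) ≤ a p n + 1 := by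
  have h := (eventually_tail_succ_le h0 hp hr (ε := 1 / 3) (by norm_num))
  filter_upwards [((tendsto_a h0 hp).comp (tendsto_add_atTop_nat 0)).eventually
    (((tendsto_add_atTop_nat 1)).eventually h), eventually_ge_atTop 1] with n hn hn1
  by_contra! hlt
  simp only [Function.comp, add_zero] at hn
  have h1 := (le_a_iff h0 hp (k := a p n + 1 + 1) (n := n + 1) (by omega)).1 (by omega)
  have h2 : n < levelTime p (a p n + 1) := by
    by_contra! h
    have := (le_a_iff h0 hp hn1).2 h
    omega
  have h3 := one_div_le_levelTime p (a p n + 1 + 1)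
  have h4 := levelTime_lt h0 hp (a p n + 1)
  have h5 : 3 * (1 / tail p (a p n + 1)) ≤ 1 / tail p (a p n + 1 + 1) := by
    have := tail_pos h0 hp (a p n + 1 + 1)
    have := tail_pos h0 hp (a p n + 1)
    rw [mul_one_div, div_le_div_iff₀ (by assumption) (by assumption)]
    linarith
  have h6 : 1 ≤ 1 / tail p (a p n + 1) :=
    (one_le_div (tail_pos h0 hp _)).2 (tail_le_one h0 hp _)
  have h7 : (levelTime p (a p n + 1 + 1) : ℝ) ≤ levelTime p (a p n + 1) := by
    exact_mod_cast h1.trans h2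
  linarith

end Tail

/-- A sequence whose downward steps are at most one visits every level between two levels that it
visits infinitely often. -/
theorem frequently_eq_of_frequently_of_steps {d : ℕ → ℤ} {u v l : ℤ} (hul : u ≤ l) (hlv : l ≤ v)
    (hd : ∀ᶠ n in atTop, d n - 1 ≤ d (n + 1)) (hu : ∃ᶠ n in atTop, d n = u)
    (hv : ∃ᶠ n in atTop, d n = v) : ∃ᶠ n in atTop, d n = l := by
  obtain ⟨N, hN⟩ := eventually_atTop.1 hd
  rw [frequently_atTop]
  intro M
  obtain ⟨s, hs, hds⟩ := frequently_atTop.1 hv (max M N)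
  obtain ⟨t, ht, hdt⟩ := frequently_atTop.1 hu s
  -- At the first such time the previous value exceeds `l`, so a drop of at most one lands exactly
  -- on `l`.
  have hex : ∃ n, s ≤ n ∧ d n ≤ l := ⟨t, ht, by omega⟩
  classical
  obtain ⟨hn, hnl⟩ := Nat.find_spec hex
  have hmin := fun j => Nat.find_min hex (m := j)
  set n := Nat.find hex
  refine ⟨n, by omega, le_antisymm hnl ?_⟩
  rcases hn.eq_or_lt with h | h
  · rw [← h]; omega
  · have h1 := hmin (n - 1) (by omega)
    have h2 := hN (n - 1) (by omega)
    rw [Nat.sub_add_cancel (by omega)] at h2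
    push Not at h1
    have := h1 (by omega)
    omega

/-! ### Independence of block events and the Borel–Cantelli lemmas. -/

section Prob

variable {Ω : Type*} [MeasurableSpace Ω] {μ : Measure Ω} {ξ : ℕ → Ω → ℕ}

theorem measurableSet_forall_lt (hm : ∀ i, Measurable (ξ i)) (s : Finset ℕ) (c : ℕ) :
    MeasurableSet {ω | ∀ i ∈ s, ξ i ω < c} := by
  have : {ω | ∀ i ∈ s, ξ i ω < c} = ⋂ i ∈ s, ξ i ⁻¹' Set.Iio c := by ext; simp
  rw [this]
  exact s.measurableSet_biInter fun i _ => hm i measurableSet_Iio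

theorem iIndepSet_forall_lt (hind : iIndepFun ξ μ) (hm : ∀ i, Measurable (ξ i))
    {s : ℕ → Finset ℕ} (hs : Pairwise (Function.onFun Disjoint s)) (c : ℕ → ℕ) :
    iIndepSet (fun k => {ω | ∀ i ∈ s k, ξ i ω < c k}) μ := by
  rw [iIndepSet_iff_meas_biInter fun k => measurableSet_forall_lt hm (s k) (c k)]
  intro t
  -- Each index lies in at most one block, so a single constraint set per index describes all the
  -- events at once.
  let C : ℕ → Set ℕ := fun i => {x | ∀ k, i ∈ s k → x < c k}
  have hC : ∀ k, {ω | ∀ i ∈ s k, ξ i ω < c k} = ⋂ i ∈ s k, ξ i ⁻¹' C i := by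
    intro k
    ext ω
    simp only [Set.mem_ofPred_eq, Set.mem_iInter, Set.mem_preimage, C]
    refine ⟨fun h i hi k' hk' => ?_, fun h i hi => h i hi k hi⟩
    obtain rfl : k = k' := by
      by_contra hne
      exact Finset.disjoint_left.1 (hs hne) hi hk'
    exact h i hi
  have hprod : ∀ u : Finset ℕ, μ (⋂ i ∈ u, ξ i ⁻¹' C i) = ∏ i ∈ u, μ (ξ i ⁻¹' C i) :=
    fun u => hind.measure_inter_preimage_eq_mul u fun _ _ => .of_discrete
  simp_rw [hC, hprod]
  rw [← Finset.prod_biUnion fun _ _ _ _ h => hs h, ← hprod]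
  congr 1
  ext ω
  simp only [Set.mem_iInter, Finset.mem_biUnion]
  exact ⟨fun h i ⟨k, hk, hi⟩ => h k hk i hi, fun h k hk i hi => h i ⟨k, hk, hi⟩⟩

theorem iIndepSet_compl {s : ℕ → Set Ω} (hs : ∀ k, MeasurableSet (s k)) (h : iIndepSet s μ) :
    iIndepSet (fun k => (s k)ᶜ) μ := by
  rw [iIndepSet_iff_meas_biInter fun k => (hs k).compl]
  intro t
  have := (h.iIndepFun_indicator (β := ℝ)).measure_inter_preimage_eq_mul t
    (sets := fun _ => {0}) fun _ _ => measurableSet_singleton _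
  have e : ∀ k, (s k).indicator (fun _ => (1 : ℝ)) ⁻¹' {0} = (s k)ᶜ := by
    intro k
    ext ω
    simp
  simpa only [e] using this

/-- The second Borel–Cantelli lemma for real-valued probabilities. -/
theorem ae_frequently_of_not_summable [IsProbabilityMeasure μ] {s : ℕ → Set Ω}
    (hs : ∀ k, MeasurableSet (s k)) (h : iIndepSet s μ)
    (hsum : ¬ Summable fun k => μ.real (s k)) : ∀ᵐ ω ∂μ, ∃ᶠ k in atTop, ω ∈ s k := by
  have htop : ∑' k, μ (s k) = ⊤ := by
    by_contra hne
    exact hsum (ENNReal.summable_toReal hne)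
  have h1 := measure_limsup_eq_one hs h htop
  have h2 := (prob_compl_eq_zero_iff (MeasurableSet.measurableSet_limsup hs)).2 h1
  filter_upwards [measure_eq_zero_iff_ae_notMem.1 h2] with ω hω
  rw [Set.notMem_compl_iff] at hω
  exact mem_limsup_iff_frequently_mem.1 hω

theorem summable_of_eventually_le {f g : ℕ → ℝ} (hg : Summable g) (hf : ∀ k, 0 ≤ f k)
    (h : ∀ᶠ k in atTop, f k ≤ g k) : Summable f :=
  summable_of_isBigO_nat hg (Asymptotics.IsBigO.of_bound 1 (by
    filter_upwards [h] with k hk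
    rw [Real.norm_of_nonneg (hf k), one_mul]
    exact hk.trans (le_abs_self _)))

/-- The first Borel–Cantelli lemma for real-valued bounds on the probabilities. -/
theorem ae_eventually_notMem_of_le [IsFiniteMeasure μ] {s : ℕ → Set Ω} {b : ℕ → ℝ}
    (hsum : Summable b) (hb : ∀ᶠ k in atTop, μ.real (s k) ≤ b k) :
    ∀ᵐ ω ∂μ, ∀ᶠ k in atTop, ω ∉ s k := by
  have hs : Summable fun k => μ.real (s k) :=
    summable_of_eventually_le hsum (fun _ => measureReal_nonneg) hb
  refine ae_eventually_notMem ?_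
  simpa only [ofReal_measureReal (measure_ne_top _ _)] using hs.tsum_ofReal_ne_top

variable [IsProbabilityMeasure μ] {p : ℕ → ℝ}

theorem measureReal_lt (h0 : ∀ i, 0 < p i) (hp : HasSum p 1) (hm : ∀ i, Measurable (ξ i))
    (hlaw : ∀ i k, μ {ω | ξ i ω = k} = ENNReal.ofReal (p k)) (i c : ℕ) :
    μ.real (ξ i ⁻¹' Set.Iio c) = 1 - tail p c := by
  have e : ξ i ⁻¹' Set.Iio c = ⋃ k ∈ Finset.range c, {ω | ξ i ω = k} := by ext; simp
  rw [e, measureReal_biUnion_finset, ← sum_range_eq_one_sub_tail hp]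
  · refine Finset.sum_congr rfl fun k _ => ?_
    rw [measureReal_def, hlaw, ENNReal.toReal_ofReal (h0 k).le]
  · intro x _ y _ hxy
    exact Set.disjoint_left.2 fun ω hx hy => hxy (by simp_all)
  · exact fun k _ => hm i (measurableSet_singleton k)

theorem measureReal_forall_lt (h0 : ∀ i, 0 < p i) (hp : HasSum p 1)
    (hm : ∀ i, Measurable (ξ i)) (hind : iIndepFun ξ μ)
    (hlaw : ∀ i k, μ {ω | ξ i ω = k} = ENNReal.ofReal (p k)) (s : Finset ℕ) (c : ℕ) :
    μ.real {ω | ∀ i ∈ s, ξ i ω < c} = (1 - tail p c) ^ s.card := by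
  have e : {ω | ∀ i ∈ s, ξ i ω < c} = ⋂ i ∈ s, ξ i ⁻¹' Set.Iio c := by ext; simp
  have := hind.measure_inter_preimage_eq_mul s (sets := fun _ => Set.Iio c)
    fun _ _ => measurableSet_Iio
  rw [e, measureReal_def, this, ENNReal.toReal_prod]
  simp_rw [← measureReal_def, measureReal_lt h0 hp hm hlaw]
  simp

theorem measureReal_exists_ge (h0 : ∀ i, 0 < p i) (hp : HasSum p 1)
    (hm : ∀ i, Measurable (ξ i)) (hind : iIndepFun ξ μ)
    (hlaw : ∀ i k, μ {ω | ξ i ω = k} = ENNReal.ofReal (p k)) (s : Finset ℕ) (c : ℕ) :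
    μ.real {ω | ∀ i ∈ s, ξ i ω < c}ᶜ = 1 - (1 - tail p c) ^ s.card := by
  rw [probReal_compl_eq_one_sub (measurableSet_forall_lt hm s c),
    measureReal_forall_lt h0 hp hm hind hlaw]

end Prob

/-! ### Elementary exponential inequalities. -/

section Bounds

theorem one_sub_one_sub_pow_le {x : ℝ} (hx : x ≤ 1) (n : ℕ) : 1 - (1 - x) ^ n ≤ n * x := by
  have := one_add_mul_le_pow (a := -x) (by linarith) n
  rw [← sub_eq_add_neg] at this
  linarith

theorem one_sub_pow_le_exp {x : ℝ} (hx : x ≤ 1) (n : ℕ) : (1 - x) ^ n ≤ Real.exp (-(n * x)) := by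
  rw [← mul_neg, Real.exp_nat_mul]
  exact pow_le_pow_left₀ (by linarith) (Real.one_sub_le_exp_neg x) n

/-- For `x ≤ 1 / 2` one has `1 / (1 - x) ≤ 1 + 2 * x ≤ exp (2 * x)`. -/
theorem exp_le_one_sub_pow {x : ℝ} (h0 : 0 ≤ x) (hx : x ≤ 1 / 2) (n : ℕ) :
    Real.exp (-(2 * (n * x))) ≤ (1 - x) ^ n := by
  have : -(2 * (n * x)) = n * (-(2 * x)) := by ring
  rw [this, Real.exp_nat_mul]
  refine pow_le_pow_left₀ (Real.exp_pos _).le ?_ n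
  rw [Real.exp_neg]
  refine inv_le_of_inv_le₀ (by linarith) ?_
  refine le_trans ?_ (Real.add_one_le_exp _)
  rw [inv_le_iff_one_le_mul₀ (by linarith)]
  nlinarith

theorem half_le_one_sub_exp_neg {t : ℝ} (h0 : 0 ≤ t) (h1 : t ≤ 1) :
    t / 2 ≤ 1 - Real.exp (-t) := by
  have h : Real.exp (-t) ≤ 1 / (1 + t) := by
    rw [Real.exp_neg, one_div]
    exact inv_anti₀ (by linarith) (by linarith [Real.add_one_le_exp t])
  have : 1 / (1 + t) ≤ 1 - t / 2 := by
    rw [div_le_iff₀ (by linarith)]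
    nlinarith
  linarith

/-- Keeping only the term `y ^ m / m!` of the series of `exp y`, with `y = exp x`, turns the double
exponential into a term of the convergent series. -/
theorem exp_neg_exp_le (m : ℕ) (x : ℝ) :
    Real.exp (-Real.exp x) ≤ m.factorial * Real.exp (-(m * x)) := by
  have h := Real.pow_div_factorial_le_exp (Real.exp x) (Real.exp_pos x).le m
  rw [← Real.exp_nat_mul, div_le_iff₀ (by positivity)] at h
  rw [Real.exp_neg, Real.exp_neg, inv_le_iff_one_le_mul₀ (Real.exp_pos _)]
  have := Real.exp_pos (m * x)
  field_simp
  linarith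

end Bounds

theorem tendsto_levelTime {p : ℕ → ℝ} (h0 : ∀ i, 0 < p i) (hp : HasSum p 1) :
    Tendsto (levelTime p) atTop atTop := by
  refine tendsto_atTop.2 fun b => ?_
  filter_upwards [eventually_gt_atTop (a p (b + 1))] with k hk
  by_contra! h
  have := (le_a_iff h0 hp (n := b + 1) (by omega)).2 (by omega : levelTime p k ≤ b + 1)
  omega

theorem levelTime_mul_tail_le {p : ℕ → ℝ} (h0 : ∀ i, 0 < p i) (hp : HasSum p 1) (k : ℕ) :
    levelTime p k * tail p k ≤ 2 := by
  have h1 := tail_pos h0 hp k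
  have h2 := levelTime_lt h0 hp k
  have h3 := mul_lt_mul_of_pos_right h2 h1
  rw [add_mul, one_div_mul_cancel h1.ne'] at h3
  linarith [tail_le_one h0 hp k]

theorem runMax_lt_iff {Ω : Type*} {ξ : ℕ → Ω → ℕ} {n c : ℕ} {ω : Ω} (hc : 0 < c) :
    runMax ξ n ω < c ↔ ∀ i ∈ Finset.range n, ξ i ω < c :=
  Finset.sup_lt_iff hc

theorem runMax_mono {Ω : Type*} {ξ : ℕ → Ω → ℕ} (ω : Ω) : Monotone fun n => runMax ξ n ω :=
  fun _ _ h => Finset.sup_mono (Finset.range_mono h)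

/-! ### The four almost sure estimates. -/

section Maxima

variable {Ω : Type*} [MeasurableSpace Ω] {μ : Measure Ω} [IsProbabilityMeasure μ]
  {p : ℕ → ℝ} {ξ : ℕ → Ω → ℕ}

theorem ae_eventually_runMax_le (h0 : ∀ i, 0 < p i) (hp : HasSum p 1)
    (hm : ∀ i, Measurable (ξ i)) (hind : iIndepFun ξ μ)
    (hlaw : ∀ i k, μ {ω | ξ i ω = k} = ENNReal.ofReal (p k))
    (hmono : MonotoneOn (r p) (Set.Ici 1)) {m : ℕ}
    (hconv : Summable fun k : ℕ => Real.exp (-((m : ℝ) * r p (k + 1)))) :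
    ∀ᵐ ω ∂μ, ∀ᶠ n in atTop, runMax ξ n ω ≤ a p n + m := by
  have hae := ae_eventually_notMem_of_le (μ := μ)
    (s := fun k => {ω | ∀ i ∈ Finset.range (levelTime p (k + 1)), ξ i ω < k + 1 + m}ᶜ)
    (((summable_nat_add_iff 1).2 hconv).mul_left 2) (Eventually.of_forall fun k => by
      rw [measureReal_exists_ge h0 hp hm hind hlaw, Finset.card_range]
      calc _ ≤ levelTime p (k + 1) * tail p (k + 1 + m) :=
            one_sub_one_sub_pow_le (tail_le_one h0 hp _) _
        _ ≤ levelTime p (k + 1) * (Real.exp (-(m * r p (k + 1 + 1))) * tail p (k + 1)) := by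
            gcongr
            exact tail_add_le h0 hp hmono _ _
        _ = levelTime p (k + 1) * tail p (k + 1) * Real.exp (-(m * r p (k + 1 + 1))) := by ring
        _ ≤ _ := by
            gcongr
            exact levelTime_mul_tail_le h0 hp _)
  filter_upwards [hae] with ω hω
  filter_upwards [(tendsto_a h0 hp).eventually hω, eventually_ge_atTop 1] with n hn hn1
  rw [Set.notMem_compl_iff] at hn
  have hlt : n < levelTime p (a p n + 1) := by
    by_contra! h
    have := (le_a_iff h0 hp hn1).2 h
    omega
  have := (runMax_lt_iff (ξ := ξ) (n := n) (ω := ω) (c := a p n + 1 + m) (by omega)).2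
    fun i hi => hn i (Finset.mem_range.2 ((Finset.mem_range.1 hi).trans hlt))
  omega

theorem ae_eventually_le_runMax (h0 : ∀ i, 0 < p i) (hp : HasSum p 1)
    (hm : ∀ i, Measurable (ξ i)) (hind : iIndepFun ξ μ)
    (hlaw : ∀ i k, μ {ω | ξ i ω = k} = ENNReal.ofReal (p k)) {m : ℕ}
    (hconv : Summable fun k : ℕ => Real.exp (-((m : ℝ) * r p (k + 1)))) :
    ∀ᵐ ω ∂μ, ∀ᶠ n in atTop, a p n ≤ runMax ξ n ω + 1 := by
  have hae := ae_eventually_notMem_of_le (μ := μ)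
    (s := fun k => {ω | ∀ i ∈ Finset.range (levelTime p (k + 1)), ξ i ω < k})
    (hconv.mul_left (m.factorial : ℝ)) (Eventually.of_forall fun k => by
      rw [measureReal_forall_lt h0 hp hm hind hlaw, Finset.card_range]
      refine (one_sub_pow_le_exp (tail_le_one h0 hp _) _).trans ?_
      refine le_trans ?_ (exp_neg_exp_le m _)
      rw [Real.exp_le_exp, neg_le_neg_iff]
      have h1 := tail_pos h0 hp k
      have h2 : Real.exp (r p (k + 1)) = 1 / tail p (k + 1) * tail p k := by
        rw [tail_succ_eq_exp_mul h0 hp, Real.exp_neg]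
        have := Real.exp_pos (r p (k + 1))
        field_simp
      rw [h2]
      exact mul_le_mul_of_nonneg_right (one_div_le_levelTime p _) h1.le)
  filter_upwards [hae] with ω hω
  filter_upwards [(tendsto_a h0 hp).eventually ((tendsto_sub_atTop_nat 1).eventually hω),
    eventually_ge_atTop 1, (tendsto_a h0 hp).eventually_ge_atTop 1] with n hn hn1 ha
  have hle := (le_a_iff h0 hp (k := a p n) hn1).1 le_rfl
  rw [Nat.sub_add_cancel ha] at hn
  by_contra! h
  refine hn fun i hi => (runMax_lt_iff (ξ := ξ) (n := n) (by omega)).1 (by omega) i ?_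
  exact Finset.mem_range.2 ((Finset.mem_range.1 hi).trans_le hle)

theorem ae_frequently_le_runMax (h0 : ∀ i, 0 < p i) (hp : HasSum p 1)
    (hm : ∀ i, Measurable (ξ i)) (hind : iIndepFun ξ μ)
    (hlaw : ∀ i k, μ {ω | ξ i ω = k} = ENNReal.ofReal (p k))
    (hmono : MonotoneOn (r p) (Set.Ici 1)) (hlim : Tendsto (r p) atTop atTop) {j : ℕ}
    (hdiv : ¬ Summable fun k : ℕ => Real.exp (-((j : ℝ) * r p (k + 1)))) :
    ∀ᵐ ω ∂μ, ∃ᶠ n in atTop, a p n + (j + 1) ≤ runMax ξ n ω := by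
  -- Variables are indexed from 0, and `levelTime p (k + 1) - 1` is the last `n` with `a p n ≤ k`;
  -- hence the shift by one.
  let s : ℕ → Finset ℕ := fun k => Finset.Ico (levelTime p k - 1) (levelTime p (k + 1) - 1)
  have hN := levelTime_mono h0 hp
  have hs : Pairwise (Function.onFun Disjoint s) := by
    have : Monotone fun k => levelTime p k - 1 := fun _ _ h => Nat.sub_le_sub_right (hN h) 1
    intro x y hxy
    refine Finset.disjoint_left.2 fun i hx hy => ?_
    simp only [s, Finset.mem_Ico] at hx hy
    rcases hxy.lt_or_gt with h | h
    · have := this (Nat.succ_le_of_lt h)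
      simp only [Nat.succ_eq_add_one] at this
      omega
    · have := this (Nat.succ_le_of_lt h)
      simp only [Nat.succ_eq_add_one] at this
      omega
  have hmeas := fun k => measurableSet_forall_lt hm (s k) (k + 1 + j)
  have hae := ae_frequently_of_not_summable (μ := μ) (fun k => (hmeas k).compl)
    (iIndepSet_compl hmeas (iIndepSet_forall_lt hind hm hs _)) (fun hsum => by
      refine hdiv ((summable_nat_add_iff j).1 ?_)
      -- One factor 2 comes from the block length `hM`, the other from `half_le_one_sub_exp_neg`.
      refine summable_of_eventually_le (hsum.mul_left 4) (fun k => (Real.exp_pos _).le) ?_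
      filter_upwards [eventually_tail_succ_le h0 hp hlim (ε := 1 / 4) (by norm_num)] with k hk
      rw [measureReal_exists_ge h0 hp hm hind hlaw]
      have hT := tail_pos h0 hp k
      have hT1 := tail_pos h0 hp (k + 1)
      have hx := tail_pos h0 hp (k + 1 + j)
      set M := (s k).card with hMdef
      have hM : 1 / tail p (k + 1) / 2 ≤ M := by
        have e : (M : ℝ) = levelTime p (k + 1) - levelTime p k := by
          rw [hMdef, Nat.card_Ico]
          have h1 := one_le_levelTime h0 hp k
          have h2 := hN (Nat.le_succ k)
          rw [← Nat.cast_sub h2]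
          congr 1
          simp only [Nat.succ_eq_add_one]
          omega
        have h1 := one_div_le_levelTime p (k + 1)
        have h2 := levelTime_lt h0 hp k
        have h3 : 1 ≤ 1 / tail p k := (one_le_div hT).2 (tail_le_one h0 hp _)
        have h4 : 4 * (1 / tail p k) ≤ 1 / tail p (k + 1) := by
          rw [mul_one_div, div_le_div_iff₀ hT hT1]
          linarith
        linarith
      set x := tail p (k + 1 + j)
      have hy1 : x / tail p (k + 1) ≤ 1 :=
        (div_le_one hT1).2 (tail_antitone h0 hp (by omega))
      have hy0 : 0 ≤ x / tail p (k + 1) := by positivity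
      have hy : Real.exp (-(j * r p (k + j + 1))) ≤ x / tail p (k + 1) := by
        rw [le_div_iff₀ hT1, show k + j + 1 = k + 1 + j by omega]
        exact le_tail_add h0 hp hmono (by omega)
      have h5 : (1 - x) ^ M ≤ Real.exp (-(x / tail p (k + 1) / 2)) := by
        refine (one_sub_pow_le_exp (tail_le_one h0 hp _) _).trans ?_
        rw [Real.exp_le_exp, neg_le_neg_iff]
        calc _ = 1 / tail p (k + 1) / 2 * x := by ring
          _ ≤ _ := by gcongr
      have h6 := half_le_one_sub_exp_neg (t := x / tail p (k + 1) / 2) (by linarith) (by linarith)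
      linarith)
  filter_upwards [hae] with ω hω
  have htend : Tendsto (fun k => levelTime p (k + 1) - 1) atTop atTop :=
    (tendsto_sub_atTop_nat 1).comp ((tendsto_levelTime h0 hp).comp (tendsto_add_atTop_nat 1))
  refine htend.frequently (hω.mono fun k hk => ?_)
  simp only [Set.mem_compl_iff, Set.mem_ofPred_eq, not_forall, not_lt] at hk
  obtain ⟨i, hi, hik⟩ := hk
  simp only [s, Finset.mem_Ico] at hi
  have h1 := one_le_levelTime h0 hp k
  have ha : ¬ k + 1 ≤ a p (levelTime p (k + 1) - 1) := by
    rw [le_a_iff h0 hp (by omega)]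
    omega
  have : ξ i ω ≤ runMax ξ (levelTime p (k + 1) - 1) ω :=
    Finset.le_sup (f := fun i => ξ i ω) (Finset.mem_range.2 hi.2)
  omega

theorem ae_frequently_runMax_lt (h0 : ∀ i, 0 < p i) (hp : HasSum p 1)
    (hm : ∀ i, Measurable (ξ i)) (hind : iIndepFun ξ μ)
    (hlaw : ∀ i k, μ {ω | ξ i ω = k} = ENNReal.ofReal (p k))
    (hlim : Tendsto (r p) atTop atTop) :
    ∀ᵐ ω ∂μ, ∃ᶠ n in atTop, runMax ξ n ω + 1 ≤ a p n := by
  -- Along `φ` the tail ratio is at most `(1 / 2) ^ j`, so exceedances before the block have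
  -- summable probability.
  obtain ⟨φ, hφ, hφT⟩ := extraction_forall_of_eventually fun j : ℕ =>
    eventually_tail_succ_le h0 hp hlim (ε := (1 / 2) ^ j) (by positivity)
  have hN := levelTime_mono h0 hp
  let s : ℕ → Finset ℕ := fun j => Finset.Ico (levelTime p (φ j)) (levelTime p (φ j + 1))
  have hs : Pairwise (Function.onFun Disjoint s) := by
    intro x y hxy
    refine Finset.disjoint_left.2 fun i hx hy => ?_
    simp only [s, Finset.mem_Ico] at hx hy
    rcases hxy.lt_or_gt with h | h
    · have := hN (show φ x + 1 ≤ φ y from hφ h)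
      omega
    · have := hN (show φ y + 1 ≤ φ x from hφ h)
      omega
  have hlate := ae_frequently_of_not_summable (μ := μ)
    (fun j => measurableSet_forall_lt hm (s j) (φ j + 1))
    (iIndepSet_forall_lt hind hm hs _) (fun hsum => by
      -- Summable terms would tend to 0, yet these are at least `exp (-4)`: twice `levelTime p k *
      -- tail p k ≤ 2`.
      have hlt := hsum.tendsto_atTop_zero.eventually_lt_const (Real.exp_pos (-4))
      obtain ⟨j, hj, hj1⟩ := (hlt.and (eventually_ge_atTop 1)).exists
      refine hj.not_ge ?_
      rw [measureReal_forall_lt h0 hp hm hind hlaw]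
      have hx := tail_pos h0 hp (φ j + 1)
      have hx2 : tail p (φ j + 1) ≤ 1 / 2 := by
        calc _ ≤ (1 / 2 : ℝ) ^ j * tail p (φ j) := hφT j
          _ ≤ (1 / 2 : ℝ) ^ 1 * 1 := by
            refine mul_le_mul (pow_le_pow_of_le_one (by norm_num) (by norm_num) hj1)
              (tail_le_one h0 hp _) (tail_pos h0 hp _).le (by norm_num)
          _ = _ := by norm_num
      refine le_trans ?_ (exp_le_one_sub_pow hx.le hx2 _)
      rw [Real.exp_le_exp, neg_le_neg_iff]
      have hcard : ((s j).card : ℝ) ≤ levelTime p (φ j + 1) := by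
        rw [Nat.card_Ico]
        exact_mod_cast Nat.sub_le _ _
      have := mul_le_mul_of_nonneg_right hcard hx.le
      linarith [levelTime_mul_tail_le h0 hp (φ j + 1)])
  have hearly := ae_eventually_notMem_of_le (μ := μ)
    (s := fun j => {ω | ∀ i ∈ Finset.range (levelTime p (φ j)), ξ i ω < φ j + 1}ᶜ)
    (summable_geometric_two.mul_left 2) (Eventually.of_forall fun j => by
      rw [measureReal_exists_ge h0 hp hm hind hlaw, Finset.card_range]
      calc _ ≤ levelTime p (φ j) * tail p (φ j + 1) :=
            one_sub_one_sub_pow_le (tail_le_one h0 hp _) _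
        _ ≤ levelTime p (φ j) * ((1 / 2) ^ j * tail p (φ j)) := by
            gcongr
            exact hφT j
        _ = levelTime p (φ j) * tail p (φ j) * (1 / 2) ^ j := by ring
        _ ≤ _ := by
            gcongr
            exact levelTime_mul_tail_le h0 hp _)
  filter_upwards [hlate, hearly] with ω h1 h2
  have htend : Tendsto (fun j => levelTime p (φ j + 1)) atTop atTop :=
    (tendsto_levelTime h0 hp).comp ((tendsto_add_atTop_nat 1).comp hφ.tendsto_atTop)
  refine htend.frequently ((h1.and_eventually h2).mono fun j ⟨hj1, hj2⟩ => ?_)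
  rw [Set.notMem_compl_iff] at hj2
  have ha := (le_a_iff h0 hp (k := φ j + 1) (one_le_levelTime h0 hp (φ j + 1))).2 le_rfl
  have := (runMax_lt_iff (ξ := ξ) (n := levelTime p (φ j + 1)) (ω := ω) (c := φ j + 1)
    (by omega)).2 fun i hi => by
      rcases lt_or_ge i (levelTime p (φ j)) with h | h
      · exact hj2 i (Finset.mem_range.2 h)
      · exact hj1 i (Finset.mem_Ico.2 ⟨h, Finset.mem_range.1 hi⟩)
  omega

end Maxima

end DiscreteExtremes

theorem corollary1 {Ω : Type*} [MeasurableSpace Ω] (μ : MeasureTheory.Measure Ω)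
    [MeasureTheory.IsProbabilityMeasure μ]
    (p : ℕ → ℝ) (hp_pos : ∀ i, 0 < p i) (hp_sum : HasSum p 1)
    (ξ : ℕ → Ω → ℕ) (hξ_meas : ∀ i, Measurable (ξ i))
    (hξ_indep : ProbabilityTheory.iIndepFun ξ μ)
    (hξ_law : ∀ i k, μ {ω | ξ i ω = k} = ENNReal.ofReal (p k))
    (hr_mono : MonotoneOn (DiscreteExtremes.r p) (Set.Ici 1))
    (hr_lim : Filter.Tendsto (DiscreteExtremes.r p) Filter.atTop Filter.atTop)
    (m : ℕ) (hm : 1 ≤ m)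
    (hconv : Summable fun k : ℕ => Real.exp (-((m : ℝ) * DiscreteExtremes.r p (k + 1))))
    (hdiv : ¬ Summable fun k : ℕ =>
      Real.exp (-(((m : ℝ) - 1) * DiscreteExtremes.r p (k + 1)))) :
    (∀ᵐ ω ∂μ, Filter.limsup (fun n : ℕ =>
        (((DiscreteExtremes.runMax ξ n ω : ℝ) - (DiscreteExtremes.a p n : ℝ) : ℝ) : EReal))
        Filter.atTop = ((m : ℝ) : EReal)) ∧
    (∀ᵐ ω ∂μ, Filter.liminf (fun n : ℕ =>
        (((DiscreteExtremes.runMax ξ n ω : ℝ) - (DiscreteExtremes.a p n : ℝ) : ℝ) : EReal))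
        Filter.atTop = ((-1 : ℝ) : EReal)) ∧
    (∀ l : ℤ, -1 ≤ l → l ≤ (m : ℤ) → ∀ᵐ ω ∂μ, ∃ᶠ n : ℕ in Filter.atTop,
        (DiscreteExtremes.runMax ξ n ω : ℤ) = (DiscreteExtremes.a p n : ℤ) + l) := by
  open Filter DiscreteExtremes in
  have hup := ae_eventually_runMax_le hp_pos hp_sum hξ_meas hξ_indep hξ_law hr_mono hconv
  have hlow := ae_eventually_le_runMax hp_pos hp_sum hξ_meas hξ_indep hξ_law hconv
  have hfneg := ae_frequently_runMax_lt hp_pos hp_sum hξ_meas hξ_indep hξ_law hr_lim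
  obtain ⟨j, rfl⟩ : ∃ j, m = j + 1 := ⟨m - 1, by omega⟩
  have hfm := ae_frequently_le_runMax (j := j) hp_pos hp_sum hξ_meas hξ_indep hξ_law hr_mono hr_lim
    (by simpa using hdiv)
  refine ⟨?_, ?_, fun l hl hlm => ?_⟩
  · filter_upwards [hup, hfm] with ω h1 h2
    refine le_antisymm (limsup_le_of_le (h := ?_)) (le_limsup_of_frequently_le ?_)
    · filter_upwards [h1] with n hn
      rw [EReal.coe_le_coe_iff, sub_le_iff_le_add']
      exact_mod_cast hn
    · refine h2.mono fun n hn => ?_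
      rw [EReal.coe_le_coe_iff, le_sub_iff_add_le']
      exact_mod_cast hn
  · filter_upwards [hlow, hfneg] with ω h1 h2
    refine le_antisymm (liminf_le_of_frequently_le ?_) (le_liminf_of_le (h := ?_))
    · refine h2.mono fun n hn => ?_
      have : (runMax ξ n ω : ℝ) + 1 ≤ a p n := by exact_mod_cast hn
      rw [EReal.coe_le_coe_iff]
      linarith
    · filter_upwards [h1] with n hn
      have : (a p n : ℝ) ≤ runMax ξ n ω + 1 := by exact_mod_cast hn
      rw [EReal.coe_le_coe_iff]
      linarith
  · filter_upwards [hup, hlow, hfm, hfneg] with ω h1 h2 h3 h4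
    have := frequently_eq_of_frequently_of_steps
      (d := fun n => (runMax ξ n ω : ℤ) - a p n) hl hlm
      -- The endpoints `-1` and `m` are hit exactly: each frequent inequality is combined with the
      -- opposite eventual one.
      ((eventually_a_succ_le hp_pos hp_sum hr_lim).mono fun n hn => by
        have := runMax_mono (ξ := ξ) ω (Nat.le_succ n)
        simp only [Nat.succ_eq_add_one] at this
        omega)
      ((h4.and_eventually h2).mono fun n hn => by omega)
      ((h3.and_eventually h1).mono fun n hn => by push_cast; omega)
    exact this.mono fun n hn => by omega
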